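/- Let $d\ge 1$ and let $D\subset\mathbb R^d$ be a bounded open set (for instance a bounded Lipschitz domain, $d\in\{2,3\}$). Let $H^1_0(D)$ be the closure of $C_c^\infty(D)$ in $H^1(D)$, and set $a(A;w,v)=\int_D A\,\nabla w\cdot\nabla v\,dx$. We use the norms $\|u\|_{H^1}^2=\|u\|_{L^2}^2+\sum_i\|\partial_i u\|_{L^2}^2$, $\|u\|_{H^2}^2=\|u\|_{H^1}^2+\sum_{i,j}\|\partial_j\partial_i u\|_{L^2}^2$ and $\|A\|_{W^{1,\infty}}=\max\{\|A\|_{L^\infty},\max_i\|\partial_iA\|_{L^\infty}\}$ on $D$, with weak derivatives. Let $C_{\rm approx},C_{\rm reg},C_{\rm unif}>0$ and $0<A_{\min}\le A_{\max}<\infty$ with $A_{\min}\le 1$, and assume the following. 1. $X_0\subseteq X_1\subseteq\dots\subset H^1_0(D)$ are closed (e.g. finite-dimensional) subspaces, and $(h_\ell)_{\ell\ge0}$ is a decreasing sequence of positive numbers with $h_\ell\to0$ and $h_{\ell+1}\ge C_{\rm unif}h_\ell$, such that $$\inf_{v\in X_\ell}\|u-v\|_{H^1(D)}\le C_{\rm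 approx}h_\ell\|u\|_{H^2(D)}\qquad\text{for all }u\in H^2(D)\cap H^1_0(D),\ \ell\ge0.$$ 2. $\Omega$ is a set and, for $\omega\in\Omega$ and $\nu\ge0$, $A^\nu(\omega)\in W^{1,\infty}(D)$ (in the application $\Omega$ is a probability space and $A^\nu$ are approximations of a random diffusion coefficient). Let $f\in L^2(D)$. Let $\omega\in\Omega$ be such that for all $\nu\ge0$ one has $A_{\min}\le A^\nu(\omega)\le A_{\max}$ a.e. in $D$, and such that for all $\nu\ge0$ and $g\in L^2(D)$ the solution $u\in H^1_0(D)$ of $a(A^\nu(\omega);u,v)=\int_D g\,v\,dx$ for all $v\in H^1_0(D)$ belongs to $H^2(D)$ with $$\|u\|_{H^2(D)}\le \frac{C_{\rm reg}}{A_{\min}^2}\bigl(1+\|A^\nu(\omega)\|_{W^{1,\infty}(D)}\bigr)\|g\|_{L^2(D)}.$$ Then for all $\ell,\nu\ge0$ there is exactly one $u_\ell^\nu(\omega)\in X_\ell$ with $a(A^\nu(\omega);u_\ell^\nu(\omega),v)=\int_D f\,v\,dx$ for all $v\in X_\ell$, and for all $\ell,\nu\ge1$ the double difference $$D_\ell^\nu(\omega):=\bigl(u_\ell^\nu(\omega)-u_{\ell-1}^\nu(\omega)\bigr)-\bigl(u_\ell^{\nu-1}(\omega)-u_{\ell-1}^{\nu-1}(\omega)\bigr)$$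 satisfies $$\|D_\ell^\nu(\omega)\|_{H^1(D)}\le C_{\rm prod}(\omega)\,h_\ell\,\|(A^\nu-A^{\nu-1})(\omega)\|_{W^{1,\infty}(D)}\|f\|_{L^2(D)},$$ $$C_{\rm prod}(\omega)=K\,C_{\rm unif}^{-1}A_{\min}^{-5}A_{\max}^{1/2}\Bigl(1+\max_{i\in\{0,1\}}\|A^{\nu-i}(\omega)\|_{W^{1,\infty}(D)}\Bigr)^2,$$ where $K>0$ depends only on $d$, $D$, $C_{\rm approx}$ and $C_{\rm reg}$; in particular $K$ does not depend on $\ell,\nu,\omega,f$, the spaces $X_\ell$, the coefficients, $A_{\min}$, $A_{\max}$ or $C_{\rm unif}$. -/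

import Mathlib

open MeasureTheory

noncomputable section

/-- `ℝ^d` with the Euclidean norm. -/
abbrev Space (d : ℕ) : Type := EuclideanSpace ℝ (Fin d)

/-- The Lebesgue space `L^2(D)`. -/
abbrev L2 (d : ℕ) (D : Set (Space d)) : Type :=
  Lp ℝ 2 ((volume : Measure (Space d)).restrict D)

/-- The Lebesgue space `L^∞(D)`. -/
abbrev LInf (d : ℕ) (D : Set (Space d)) : Type :=
  Lp ℝ ⊤ ((volume : Measure (Space d)).restrict D)

/-- Classical partial derivative `∂_i φ`. -/
def partialDeriv {d : ℕ} (i : Fin d) (φ : Space d → ℝ) (x : Space d) : ℝ :=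
  fderiv ℝ φ x (EuclideanSpace.single i 1)

/-- `φ ∈ C_c^∞(D)`. -/
structure IsTestFunction {d : ℕ} (D : Set (Space d)) (φ : Space d → ℝ) : Prop where
  contDiff : ContDiff ℝ ((⊤ : ℕ∞) : WithTop ℕ∞) φ
  hasCompactSupport : HasCompactSupport φ
  tsupport_subset : tsupport φ ⊆ D

/-- `g` is the weak partial derivative `∂_i u` on `D`
(used for `u`, `g` in `L^p(D)` with `p = 2` or `p = ∞`). -/
def IsWeakPartial {d : ℕ} (D : Set (Space d)) (i : Fin d) (u g : Space d → ℝ) : Prop :=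
  ∀ φ : Space d → ℝ, IsTestFunction D φ →
    ∫ x in D, u x * partialDeriv i φ x = - ∫ x in D, g x * φ x

theorem IsTestFunction.continuous_partialDeriv {d : ℕ} {D : Set (Space d)} {φ : Space d → ℝ}
    (hφ : IsTestFunction D φ) (i : Fin d) : Continuous (partialDeriv i φ) :=
  (hφ.contDiff.continuous_fderiv (by simp)).clm_apply continuous_const

theorem IsTestFunction.hasCompactSupport_partialDeriv {d : ℕ} {D : Set (Space d)}
    {φ : Space d → ℝ} (hφ : IsTestFunction D φ) (i : Fin d) :
    HasCompactSupport (partialDeriv i φ) :=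
  (hφ.hasCompactSupport.fderiv (𝕜 := ℝ)).comp_left
    (g := fun T : Space d →L[ℝ] ℝ => T (EuclideanSpace.single i 1)) rfl

theorem integrable_lp_mul {d : ℕ} {D : Set (Space d)} {p : ENNReal} [Fact (1 ≤ p)]
    (u : Lp ℝ p ((volume : Measure (Space d)).restrict D)) {ψ : Space d → ℝ}
    (hc : Continuous ψ) (hs : HasCompactSupport ψ) :
    Integrable (fun x => u x * ψ x) (volume.restrict D) := by
  have h := ((Lp.memLp u).locallyIntegrable Fact.out).integrable_smul_left_of_hasCompactSupport
    hc hs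
  refine h.congr (Filter.Eventually.of_forall fun x => ?_)
  simp [mul_comm]

theorem isWeakPartial_zero {d : ℕ} {D : Set (Space d)} {p : ENNReal} [Fact (1 ≤ p)]
    (i : Fin d) :
    IsWeakPartial D i (0 : Lp ℝ p ((volume : Measure (Space d)).restrict D))
      (0 : Lp ℝ p ((volume : Measure (Space d)).restrict D)) := by
  intro φ _
  have h := Lp.coeFn_zero ℝ p ((volume : Measure (Space d)).restrict D)
  have h1 : ∀ ψ : Space d → ℝ,
      ∫ x in D, (0 : Lp ℝ p ((volume : Measure (Space d)).restrict D)) x * ψ x = 0 := by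
    intro ψ
    refine integral_eq_zero_of_ae ?_
    filter_upwards [h] with x hx
    rw [hx, Pi.zero_apply, zero_mul]
  rw [h1, h1, neg_zero]

theorem isWeakPartial_add {d : ℕ} {D : Set (Space d)} {p : ENNReal} [Fact (1 ≤ p)]
    {i : Fin d} {u v g k : Lp ℝ p ((volume : Measure (Space d)).restrict D)}
    (hu : IsWeakPartial D i u g) (hv : IsWeakPartial D i v k) :
    IsWeakPartial D i (u + v : Lp ℝ p ((volume : Measure (Space d)).restrict D))
      (g + k : Lp ℝ p ((volume : Measure (Space d)).restrict D)) := by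
  intro φ hφ
  have key : ∀ (a b : Lp ℝ p ((volume : Measure (Space d)).restrict D)) (ψ : Space d → ℝ),
      Continuous ψ → HasCompactSupport ψ →
      ∫ x in D, (a + b : Lp ℝ p ((volume : Measure (Space d)).restrict D)) x * ψ x
        = (∫ x in D, a x * ψ x) + ∫ x in D, b x * ψ x := by
    intro a b ψ hc hs
    rw [← integral_add (integrable_lp_mul a hc hs) (integrable_lp_mul b hc hs)]
    refine integral_congr_ae ?_
    filter_upwards [Lp.coeFn_add a b] with x hx
    rw [hx, Pi.add_apply, add_mul]
  rw [key _ _ _ (hφ.continuous_partialDeriv i) (hφ.hasCompactSupport_partialDeriv i),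
    key _ _ _ hφ.contDiff.continuous hφ.hasCompactSupport, hu φ hφ, hv φ hφ, neg_add]

theorem isWeakPartial_smul {d : ℕ} {D : Set (Space d)} {p : ENNReal} [Fact (1 ≤ p)]
    {i : Fin d} (c : ℝ) {u g : Lp ℝ p ((volume : Measure (Space d)).restrict D)}
    (hu : IsWeakPartial D i u g) :
    IsWeakPartial D i (c • u : Lp ℝ p ((volume : Measure (Space d)).restrict D))
      (c • g : Lp ℝ p ((volume : Measure (Space d)).restrict D)) := by
  intro φ hφ
  have key : ∀ (a : Lp ℝ p ((volume : Measure (Space d)).restrict D)) (ψ : Space d → ℝ),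
      ∫ x in D, (c • a : Lp ℝ p ((volume : Measure (Space d)).restrict D)) x * ψ x
        = c * ∫ x in D, a x * ψ x := by
    intro a ψ
    rw [← integral_const_mul]
    refine integral_congr_ae ?_
    filter_upwards [Lp.coeFn_smul c a] with x hx
    rw [hx, Pi.smul_apply, smul_eq_mul, mul_assoc]
  rw [key, key, hu φ hφ, mul_neg]

/-- `W^{1,∞}(D)`: pairs `(A, ∇A)` with `A` and its weak partial derivatives in `L^∞(D)`.
The norm inherited from the product is `max (‖A‖_{L^∞}, max_i ‖∂_i A‖_{L^∞})`. -/
def W1Inf (d : ℕ) (D : Set (Space d)) : Submodule ℝ (LInf d D × (Fin d → LInf d D)) where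
  carrier := {A | ∀ i, IsWeakPartial D i A.1 (A.2 i)}
  zero_mem' := fun i => isWeakPartial_zero i
  add_mem' := fun ha hb i => isWeakPartial_add (ha i) (hb i)
  smul_mem' := fun c _ ha i => isWeakPartial_smul c (ha i)

/-- The Hilbert space `L^2(D) × L^2(D)^d`, in which `H^1(D)` is realised as the set of pairs
`(u, ∇u)`. The norm of `(u, g)` is `(‖u‖² + ∑ i, ‖g i‖²)^{1/2}`. -/
abbrev L2Jet (d : ℕ) (D : Set (Space d)) : Type :=
  WithLp 2 (L2 d D × PiLp 2 (fun _ : Fin d => L2 d D))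

/-- `H^1(D)`: pairs `(u, ∇u)` with `u` and its weak partial derivatives in `L^2(D)`,
with the full norm `‖u‖_{H^1}² = ‖u‖_{L^2}² + ∑ i, ‖∂_i u‖_{L^2}²`. -/
def SobolevH1 (d : ℕ) (D : Set (Space d)) : Submodule ℝ (L2Jet d D) where
  carrier := {u | ∀ i, IsWeakPartial D i u.fst (u.snd i)}
  zero_mem' := fun i => isWeakPartial_zero i
  add_mem' := fun ha hb i => isWeakPartial_add (ha i) (hb i)
  smul_mem' := fun c _ ha i => isWeakPartial_smul c (ha i)

/-- `H^1_0(D)`: the closure of `{(φ, ∇φ) : φ ∈ C_c^∞(D)}` in the `H^1` norm. -/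
def SobolevH10 (d : ℕ) (D : Set (Space d)) : Submodule ℝ (L2Jet d D) :=
  (Submodule.span ℝ {u : L2Jet d D | ∃ φ : Space d → ℝ, IsTestFunction D φ ∧
    (u.fst =ᵐ[volume.restrict D] φ) ∧
    ∀ i, u.snd i =ᵐ[volume.restrict D] partialDeriv i φ}).topologicalClosure

/-- `H^2(D)`: triples `(u, ∇u, ∇²u)` with `(u, ∇u) ∈ H^1(D)` and weak second derivatives
`∂_j ∂_i u` in `L^2(D)`, with norm
`‖u‖_{H^2}² = ‖u‖_{H^1}² + ∑ i j, ‖∂_j ∂_i u‖_{L^2}²`. -/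
def SobolevH2 (d : ℕ) (D : Set (Space d)) :
    Submodule ℝ (WithLp 2 (L2Jet d D × PiLp 2 (fun _ : Fin d × Fin d => L2 d D))) where
  carrier := {u | u.fst ∈ SobolevH1 d D ∧
    ∀ i j, IsWeakPartial D j (u.fst.snd i) (u.snd (i, j))}
  zero_mem' := ⟨(SobolevH1 d D).zero_mem, fun _ j => isWeakPartial_zero j⟩
  add_mem' := fun ha hb =>
    ⟨(SobolevH1 d D).add_mem ha.1 hb.1, fun i j => isWeakPartial_add (ha.2 i j) (hb.2 i j)⟩
  smul_mem' := fun c _ ha =>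
    ⟨(SobolevH1 d D).smul_mem c ha.1, fun i j => isWeakPartial_smul c (ha.2 i j)⟩

/-- The element `(u, ∇u)` of `H^1(D)` underlying an element of `H^2(D)`. -/
def SobolevH2.toH1 {d : ℕ} {D : Set (Space d)} (u : SobolevH2 d D) : L2Jet d D :=
  (u : WithLp 2 (L2Jet d D × PiLp 2 (fun _ : Fin d × Fin d => L2 d D))).fst

/-- The bilinear form `a(A; w, v) = ∫_D A ∇w · ∇v dx`. -/
def diffusionForm {d : ℕ} {D : Set (Space d)} (A : W1Inf d D) (w v : SobolevH10 d D) : ℝ :=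
  ∫ x in D, A.1.1 x * ∑ i, w.1.snd i x * v.1.snd i x

/-- `u ∈ X` and `a(A; u, v) = ∫_D f v dx` for all `v ∈ X`. For `X = ⊤`, `u` is the exact weak
solution in `H^1_0(D)` of `-div(A ∇u) = f`. -/
def IsGalerkinSolution {d : ℕ} {D : Set (Space d)} (A : W1Inf d D)
    (X : Submodule ℝ (SobolevH10 d D)) (f : L2 d D) (u : SobolevH10 d D) : Prop :=
  u ∈ X ∧ ∀ v ∈ X, diffusionForm A u v = ∫ x in D, f x * v.1.fst x

open Classical in
/-- The Galerkin approximation in `X` (the value `0` is used if there is none). -/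
def galerkinSolution {d : ℕ} {D : Set (Space d)} (A : W1Inf d D)
    (X : Submodule ℝ (SobolevH10 d D)) (f : L2 d D) : SobolevH10 d D :=
  if h : ∃ u, IsGalerkinSolution A X f u then h.choose else 0

/-- `D_ℓ^ν = (u_ℓ^ν - u_{ℓ-1}^ν) - (u_ℓ^{ν-1} - u_{ℓ-1}^{ν-1})`, meant for `ℓ, ν ≥ 1`. -/
def doubleDifference {d : ℕ} {D : Set (Space d)} (A : ℕ → W1Inf d D)
    (X : ℕ → Submodule ℝ (SobolevH10 d D)) (f : L2 d D) (ℓ ν : ℕ) : SobolevH10 d D :=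
  (galerkinSolution (A ν) (X ℓ) f - galerkinSolution (A ν) (X (ℓ - 1)) f)
    - (galerkinSolution (A (ν - 1)) (X ℓ) f - galerkinSolution (A (ν - 1)) (X (ℓ - 1)) f)

/-- Nested closed subspaces `X_ℓ` of `H^1_0(D)` with mesh sizes `h_ℓ > 0` decreasing to `0`,
`h_{ℓ+1} ≥ C_unif h_ℓ`, and the approximation property
`inf_{v ∈ X_ℓ} ‖u - v‖_{H^1} ≤ C_approx h_ℓ ‖u‖_{H^2}` for `u ∈ H^2(D) ∩ H^1_0(D)`. -/
structure IsApproximationSequence {d : ℕ} {D : Set (Space d)}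
    (X : ℕ → Submodule ℝ (SobolevH10 d D)) (h : ℕ → ℝ) (Capprox Cunif : ℝ) : Prop where
  nested : Monotone X
  closed : ∀ ℓ, IsClosed (X ℓ : Set (SobolevH10 d D))
  pos : ∀ ℓ, 0 < h ℓ
  antitone : Antitone h
  tendsto : Filter.Tendsto h Filter.atTop (nhds 0)
  unif : ∀ ℓ, Cunif * h ℓ ≤ h (ℓ + 1)
  approx : ∀ (ℓ : ℕ) (u : SobolevH10 d D) (w : SobolevH2 d D), SobolevH2.toH1 w = u →
    ⨅ v : X ℓ, ‖u - v‖ ≤ Capprox * h ℓ * ‖w‖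

/-- The coefficient takes values in `[Amin, Amax]` almost everywhere in `D`. -/
def CoefficientBounds {d : ℕ} {D : Set (Space d)} (A : W1Inf d D) (Amin Amax : ℝ) : Prop :=
  ∀ᵐ x ∂((volume : Measure (Space d)).restrict D), Amin ≤ A.1.1 x ∧ A.1.1 x ≤ Amax

/-- `H^2`-regularity: for every `g ∈ L^2(D)` the exact solution `u ∈ H^1_0(D)` of
`-div(A ∇u) = g` lies in `H^2(D)` and
`‖u‖_{H^2} ≤ C_reg Amin^{-2} (1 + ‖A‖_{W^{1,∞}}) ‖g‖_{L^2}`. -/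
def H2Regular {d : ℕ} {D : Set (Space d)} (A : W1Inf d D) (Amin Creg : ℝ) : Prop :=
  ∀ (g : L2 d D) (u : SobolevH10 d D), IsGalerkinSolution A ⊤ g u →
    ∃ w : SobolevH2 d D, SobolevH2.toH1 w = u ∧ ‖w‖ ≤ Creg / Amin ^ 2 * (1 + ‖A‖) * ‖g‖

end

/-! Compare every discrete solution with the exact one. Let `u`, `w` be the exact solutions for the
coefficients `A`, `B` (consecutive `ν`) and `p`, `q` their Galerkin approximations in one space. The
exact solutions cancel from the double difference, which becomes the difference of the error gaps
`(u - p) - (w - q)` on levels `ℓ - 1` and `ℓ`. It remains to bound one such gap by the product of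
`h` and `‖A - B‖`.

Split the gap with the projection `s` of `u - w` onto the discrete space, orthogonal for the form of
`A` (`norm_galerkin_error_sub_le`). The part `(u - w) - s` is a best-approximation error. Since `u -
w` solves the equation for `A` with right-hand side `div ((A - B)∇w)`, which is in `L²` and of size
`‖A - B‖ ‖w‖_{H²}`, `H²`-regularity gives the factors `h` and `‖A - B‖`. The other part `s - (p -
q)` is discrete; by Galerkin orthogonality it is driven only by the difference of the two forms
acting on `w - q`, giving `‖A - B‖` from the forms and `h` from Céa's lemma for `w`.

The analytic input is Poincaré's inequality on `H^1_0(D)` for coercivity, and the product rule for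
`W^{1,∞}` times weakly differentiable `L²` functions (`isWeakPartial_mul`), which justifies the new
right-hand side. -/

noncomputable section

/-! ### Abstract Galerkin theory for symmetric coercive forms on a Hilbert space. -/

section Galerkin

variable {H : Type*} [NormedAddCommGroup H] [InnerProductSpace ℝ H]

/-- Lax–Milgram on a complete subspace. -/
theorem existsUnique_galerkin (X : Submodule ℝ H) [CompleteSpace X] (B : H →L[ℝ] H →L[ℝ] ℝ)
    {α : ℝ} (hα : 0 < α) (hB : ∀ v, α * ‖v‖ ^ 2 ≤ B v v) (F : H →L[ℝ] ℝ) :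
    ∃! u, u ∈ X ∧ ∀ v ∈ X, B u v = F v := by
  let BX : X →L[ℝ] X →L[ℝ] ℝ := B.bilinearComp X.subtypeL X.subtypeL
  have hBX : ∀ u v : X, BX u v = B u v := fun _ _ => rfl
  have hc : IsCoercive BX := ⟨α, hα, fun u => by
    have := hB u
    rw [hBX]
    simpa [sq, mul_assoc] using this⟩
  let FX : X →L[ℝ] ℝ := F.comp X.subtypeL
  let r : X := (InnerProductSpace.toDual ℝ X).symm FX
  let u : X := hc.continuousLinearEquivOfBilin.symm r
  have hu : ∀ v : X, B u v = F v := by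
    intro v
    rw [← hBX, ← hc.continuousLinearEquivOfBilin_apply]
    simp only [u, ContinuousLinearEquiv.apply_symm_apply, r,
      InnerProductSpace.toDual_symm_apply]
    rfl
  refine ⟨u, ⟨u.2, fun v hv => hu ⟨v, hv⟩⟩, ?_⟩
  rintro w ⟨hwX, hw⟩
  have hd : w - u ∈ X := X.sub_mem hwX u.2
  have h0 : B (w - u) (w - u) = 0 := by
    rw [B.map_sub₂, hw _ hd, hu ⟨_, hd⟩, sub_self]
  have h1 := hB (w - u)
  rw [h0] at h1
  have h2 : ‖w - (u : H)‖ ^ 2 ≤ 0 := by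
    by_contra h
    have := mul_pos hα (not_le.1 h)
    linarith
  have h3 : ‖w - (u : H)‖ = 0 := by
    nlinarith [norm_nonneg (w - (u : H))]
  exact sub_eq_zero.1 (norm_eq_zero.1 h3)

/-- Céa's lemma for a symmetric form. -/
theorem norm_sub_galerkin_le {X : Submodule ℝ H} {B : H →L[ℝ] H →L[ℝ] ℝ} {α β : ℝ} (hα : 0 < α)
    (hB : ∀ v, α * ‖v‖ ^ 2 ≤ B v v) (hB' : ∀ v, B v v ≤ β * ‖v‖ ^ 2)
    (hsymm : ∀ v w, B v w = B w v) {u p v : H} (hp : p ∈ X) (hv : v ∈ X)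
    (horth : ∀ v ∈ X, B (u - p) v = 0) : ‖u - p‖ ≤ √(β / α) * ‖u - v‖ := by
  have hpv : p - v ∈ X := X.sub_mem hp hv
  have hsplit : u - v = (u - p) + (p - v) := by abel
  have h0 := horth _ hpv
  have h0' : B (p - v) (u - p) = 0 := by rw [hsymm, h0]
  -- Pythagoras in the energy inner product. Symmetry is what improves the constant from `β / α` to
  -- its square root, hence the factor `√Amax` in the end.
  have hexp : B (u - v) (u - v) = B (u - p) (u - p) + B (p - v) (p - v) := by
    rw [hsplit, B.map_add₂, map_add, map_add, h0, h0']
    ring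
  have hpos : 0 ≤ B (p - v) (p - v) := le_trans (by positivity) (hB _)
  have hle : α * ‖u - p‖ ^ 2 ≤ β * ‖u - v‖ ^ 2 := by
    linarith [hB (u - p), hB' (u - v)]
  have hsq : ‖u - p‖ ^ 2 ≤ β / α * ‖u - v‖ ^ 2 := by
    rw [div_mul_eq_mul_div, le_div_iff₀ hα]
    linarith
  calc ‖u - p‖ = √(‖u - p‖ ^ 2) := (Real.sqrt_sq (norm_nonneg _)).symm
    _ ≤ √(β / α * ‖u - v‖ ^ 2) := Real.sqrt_le_sqrt hsq
    _ = √(β / α) * ‖u - v‖ := by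
      rw [Real.sqrt_mul' _ (sq_nonneg _), Real.sqrt_sq (norm_nonneg _)]

theorem norm_sub_galerkin_le_iInf {X : Submodule ℝ H} {B : H →L[ℝ] H →L[ℝ] ℝ} {α β : ℝ}
    (hα : 0 < α) (hB : ∀ v, α * ‖v‖ ^ 2 ≤ B v v) (hB' : ∀ v, B v v ≤ β * ‖v‖ ^ 2)
    (hsymm : ∀ v w, B v w = B w v) {u p : H} (hp : p ∈ X)
    (horth : ∀ v ∈ X, B (u - p) v = 0) : ‖u - p‖ ≤ √(β / α) * ⨅ v : X, ‖u - v‖ := by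
  rw [Real.mul_iInf_of_nonneg (Real.sqrt_nonneg _)]
  exact le_ciInf fun v => norm_sub_galerkin_le hα hB hB' hsymm hp v.2 horth

/-- Comparison of the Galerkin errors for two symmetric coercive forms. -/
theorem norm_galerkin_error_sub_le {X : Submodule ℝ H} [CompleteSpace X]
    {B₁ B₂ : H →L[ℝ] H →L[ℝ] ℝ} {α β δ : ℝ} (hα : 0 < α) (hδ : 0 ≤ δ)
    (h₁ : ∀ v, α * ‖v‖ ^ 2 ≤ B₁ v v) (h₁' : ∀ v, B₁ v v ≤ β * ‖v‖ ^ 2)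
    (hs₁ : ∀ v w, B₁ v w = B₁ w v)
    (h₂ : ∀ v, α * ‖v‖ ^ 2 ≤ B₂ v v) (h₂' : ∀ v, B₂ v v ≤ β * ‖v‖ ^ 2)
    (hs₂ : ∀ v w, B₂ v w = B₂ w v)
    (hdiff : ∀ v w, |B₁ v w - B₂ v w| ≤ δ * ‖v‖ * ‖w‖) {u w p q : H} (hp : p ∈ X) (hq : q ∈ X)
    (hup : ∀ v ∈ X, B₁ (u - p) v = 0) (hwq : ∀ v ∈ X, B₂ (w - q) v = 0) {a b : ℝ}
    (ha : ⨅ v : X, ‖(u - w) - v‖ ≤ a) (hb : ⨅ v : X, ‖w - v‖ ≤ b) :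
    ‖(u - p) - (w - q)‖ ≤ √(β / α) * (a + α⁻¹ * δ * b) := by
  -- `s` is the `B₁`-orthogonal projection of `u - w` onto `X`.
  obtain ⟨s, ⟨hsX, hs⟩, -⟩ := existsUnique_galerkin X B₁ hα h₁ (B₁ (u - w))
  have e1 : ‖(u - w) - s‖ ≤ √(β / α) * a :=
    (norm_sub_galerkin_le_iInf hα h₁ h₁' hs₁ hsX fun v hv => by
      rw [B₁.map_sub₂, hs v hv, sub_self]).trans
      (mul_le_mul_of_nonneg_left ha (Real.sqrt_nonneg _))
  have e2 : ‖w - q‖ ≤ √(β / α) * b :=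
    (norm_sub_galerkin_le_iInf hα h₂ h₂' hs₂ hq hwq).trans
      (mul_le_mul_of_nonneg_left hb (Real.sqrt_nonneg _))
  obtain ⟨z, hz⟩ : ∃ z, z = s - (p - q) := ⟨_, rfl⟩
  have hzX : z ∈ X := hz ▸ X.sub_mem hsX (X.sub_mem hp hq)
  -- `B₁ s z = B₁ (u - w) z`, so subtracting `B₁ (p - q) z` leaves `B₁ (u - p) z - B₁ (w - q) z`.
  -- The first term vanishes by orthogonality, and `B₂ (w - q) z = 0` may be inserted for free.
  have hBz : B₁ z z = -(B₁ (w - q) z - B₂ (w - q) z) := by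
    have k1 := hs z hzX
    have k2 := hup z hzX
    have k3 := hwq z hzX
    have k4 : B₁ z z = B₁ s z - (B₁ p z - B₁ q z) := by
      have : B₁ z = B₁ s - (B₁ p - B₁ q) := by rw [hz, map_sub, map_sub]
      rw [this]
      rfl
    simp only [map_sub, sub_apply] at k1 k2 k3 ⊢
    linarith
  have hzz : α * ‖z‖ ^ 2 ≤ δ * ‖w - q‖ * ‖z‖ :=
    (h₁ z).trans (by rw [hBz]; exact (neg_le_abs _).trans (hdiff _ _))
  have e3 : ‖z‖ ≤ α⁻¹ * (δ * ‖w - q‖) := by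
    rw [← div_eq_inv_mul, le_div_iff₀ hα]
    rcases (norm_nonneg z).eq_or_lt with h0 | h0
    · rw [← h0]; simp; positivity
    · nlinarith
  have hsplit : (u - p) - (w - q) = ((u - w) - s) + z := by rw [hz]; abel
  calc ‖(u - p) - (w - q)‖ ≤ ‖(u - w) - s‖ + ‖z‖ := by rw [hsplit]; exact norm_add_le _ _
    _ ≤ √(β / α) * a + α⁻¹ * (δ * (√(β / α) * b)) := by gcongr; exact e3.trans (by gcongr)
    _ = √(β / α) * (a + α⁻¹ * δ * b) := by ring

end Galerkin

end

noncomputable section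

open Filter Topology Convolution ContinuousLinearMap Metric

/-! ### Mollification of `L^∞` coefficients and the weak product rule. -/

section Mollify

variable {d : ℕ} {D : Set (Space d)}

theorem aestronglyMeasurable_indicator_lInf (hD : IsOpen D) (c : LInf d D) :
    AEStronglyMeasurable (D.indicator c) (volume : Measure (Space d)) :=
  (aestronglyMeasurable_indicator_iff hD.measurableSet).2 (Lp.aestronglyMeasurable c)

theorem norm_indicator_lInf_le (hD : IsOpen D) (c : LInf d D) :
    ∀ᵐ x, ‖D.indicator c x‖ ≤ ‖c‖ := by
  have h : ∀ᵐ x ∂(volume.restrict D), ‖c x‖ ≤ ‖c‖ := by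
    filter_upwards [ae_le_eLpNormEssSup (f := c) (μ := volume.restrict D)] with x hx
    rw [Lp.norm_def, eLpNorm_exponent_top]
    have hfin := Lp.eLpNorm_ne_top c
    rw [eLpNorm_exponent_top] at hfin
    simpa using ENNReal.toReal_mono hfin hx
  filter_upwards [(ae_restrict_iff' hD.measurableSet).1 h] with x hx
  by_cases hxD : x ∈ D
  · simpa [hxD] using hx hxD
  · simp [hxD]

theorem locallyIntegrable_indicator_lInf (hD : IsOpen D) (c : LInf d D) :
    LocallyIntegrable (D.indicator c) (volume : Measure (Space d)) := by
  have : MemLp (D.indicator c) ⊤ (volume : Measure (Space d)) :=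
    memLp_top_of_bound (aestronglyMeasurable_indicator_lInf hD c) _ (norm_indicator_lInf_le hD c)
  exact this.locallyIntegrable le_top

/-- The convolution `η * c` of `c ∈ L^∞(D)`, extended by zero, with a normalised bump function. -/
def mollify (η : ContDiffBump (0 : Space d)) (c : LInf d D) : Space d → ℝ :=
  η.normed volume ⋆[lsmul ℝ ℝ, volume] D.indicator c

variable (η : ContDiffBump (0 : Space d))

theorem mollify_eq_integral (hD : IsOpen D) (c : LInf d D) (x : Space d) :
    mollify η c x = ∫ t in D, c t * η.normed volume (x - t) := by
  rw [mollify, convolution_eq_swap, ← integral_indicator hD.measurableSet]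
  congr 1
  ext t
  by_cases ht : t ∈ D <;> simp [ht, mul_comm]

theorem contDiff_mollify (hD : IsOpen D) (c : LInf d D) :
    ContDiff ℝ ((⊤ : ℕ∞) : WithTop ℕ∞) (mollify η c) :=
  η.hasCompactSupport_normed.contDiff_convolution_left _ η.contDiff_normed
    (locallyIntegrable_indicator_lInf hD c)

theorem norm_mollify_le (hD : IsOpen D) (c : LInf d D) (x : Space d) :
    ‖mollify η c x‖ ≤ ‖c‖ := by
  rw [mollify, convolution_eq_swap]
  have hint : Integrable (fun t => ‖c‖ * η.normed volume (x - t)) (volume : Measure (Space d)) :=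
    (η.integrable_normed.comp_sub_left x).const_mul _
  refine (norm_integral_le_of_norm_le hint ?_).trans_eq ?_
  · filter_upwards [norm_indicator_lInf_le hD c] with t ht
    rw [lsmul_apply, norm_smul, Real.norm_of_nonneg (η.nonneg_normed _), mul_comm]
    exact mul_le_mul_of_nonneg_right ht (η.nonneg_normed _)
  · rw [integral_const_mul, integral_sub_left_eq_self (η.normed volume) volume x,
      η.integral_normed, mul_one]

theorem isTestFunction_normed_sub {x : Space d} (hx : closedBall x η.rOut ⊆ D) :
    IsTestFunction D (fun t => η.normed volume (x - t)) where
  contDiff := η.contDiff_normed.comp (contDiff_const.sub contDiff_id)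
  hasCompactSupport :=
    η.hasCompactSupport_normed.comp_homeomorph (Homeomorph.subLeft x)
  tsupport_subset := by
    refine subset_trans (closure_minimal ?_ isClosed_closedBall) hx
    intro t ht
    have : x - t ∈ Function.support (η.normed volume) := ht
    rw [η.support_normed_eq, mem_ball_zero_iff] at this
    rw [mem_closedBall, dist_comm, dist_eq_norm]
    exact this.le

/-- The derivative falls on the bump, and `t ↦ η (x - t)` is an admissible test function for the
weak derivative of `c`. Extension by zero may create jumps across `∂D`, so the ball around `x` has
to stay inside `D`. -/
theorem partialDeriv_mollify (hD : IsOpen D) {i : Fin d} {c c' : LInf d D}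
    (hc : IsWeakPartial D i c c') {x : Space d} (hx : closedBall x η.rOut ⊆ D) :
    partialDeriv i (mollify η c) x = mollify η c' x := by
  have hsmooth : ContDiff ℝ 1 (η.normed (volume : Measure (Space d))) :=
    η.contDiff_normed (n := 1)
  have hflip : mollify η c = D.indicator c ⋆[(lsmul ℝ ℝ).flip, volume] η.normed volume := by
    rw [convolution_flip]; rfl
  have hder := η.hasCompactSupport_normed.hasFDerivAt_convolution_right (lsmul ℝ ℝ).flip
    (locallyIntegrable_indicator_lInf hD c) hsmooth x
  rw [← hflip] at hder
  rw [partialDeriv, hder.fderiv, convolution_precompR_apply _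
    (locallyIntegrable_indicator_lInf hD c) (η.hasCompactSupport_normed.fderiv (𝕜 := ℝ))
    (hsmooth.continuous_fderiv one_ne_zero)]
  have htest := isTestFunction_normed_sub η hx
  have hpd : ∀ t, partialDeriv i (fun t => η.normed volume (x - t)) t
      = -(fderiv ℝ (η.normed volume) (x - t) (EuclideanSpace.single i 1)) := by
    intro t
    have h1 := (hsmooth.differentiable one_ne_zero (x - t)).hasFDerivAt.comp t
      ((hasFDerivAt_id t).const_sub x)
    have h2 : fderiv ℝ (fun t => η.normed volume (x - t)) t = _ := h1.fderiv
    rw [partialDeriv, h2]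
    simp
  have h := hc _ htest
  rw [← mollify_eq_integral η hD] at h
  simp only [hpd, mul_neg, integral_neg, neg_inj] at h
  rw [← h, convolution_def, ← integral_indicator hD.measurableSet]
  congr 1
  ext t
  by_cases ht : t ∈ D <;> simp [ht, mul_comm]

/-- Only the coefficient is mollified: a smooth multiple of `φ` is again a test function for `p`.
The mollified coefficients are bounded uniformly and converge almost everywhere, so dominated
convergence passes to the limit. -/
theorem isWeakPartial_mul (hD : IsOpen D) {i : Fin d} {c c' : LInf d D} {p p' : L2 d D}
    (hc : IsWeakPartial D i c c') (hp : IsWeakPartial D i p p') {φ : Space d → ℝ}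
    (hφ : IsTestFunction D φ) :
    ∫ x in D, p x * (c' x * φ x + c x * partialDeriv i φ x) = -∫ x in D, p' x * (c x * φ x) := by
  obtain ⟨r, hr, hrD⟩ := hφ.hasCompactSupport.isCompact.exists_cthickening_subset_open hD
    hφ.tsupport_subset
  -- Radii below `r` keep all balls centred on the support of `φ` inside `D`. The fixed ratio of
  -- outer to inner radius is what almost-everywhere convergence requires.
  let η : ℕ → ContDiffBump (0 : Space d) := fun n =>
    ⟨r / (n + 1) / 2, r / (n + 1), by positivity, half_lt_self (by positivity)⟩
  have hηr : ∀ n, (η n).rOut ≤ r := fun n => div_le_self hr.le (by simp)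
  have hη0 : Tendsto (fun n => (η n).rOut) atTop (𝓝 0) := by
    have := tendsto_one_div_add_atTop_nhds_zero_nat (𝕜 := ℝ)
    simpa [η, div_eq_mul_inv] using this.const_mul r
  have hη2 : ∀ᶠ n in atTop, (η n).rOut ≤ 2 * (η n).rIn := Eventually.of_forall fun n => by
    simp only [η]; linarith
  have hconv : ∀ b : LInf d D, ∀ᵐ x ∂(volume.restrict D),
      Tendsto (fun n => mollify (η n) b x) atTop (𝓝 (b x)) := by
    intro b
    have h := ContDiffBump.ae_convolution_tendsto_right_of_locallyIntegrable hη0 hη2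
      (locallyIntegrable_indicator_lInf hD b)
    filter_upwards [ae_restrict_of_ae h, ae_restrict_mem hD.measurableSet] with x hx hxD
    rw [Set.indicator_of_mem hxD] at hx
    exact hx
  have hball : ∀ n, ∀ x ∈ tsupport φ, closedBall x (η n).rOut ⊆ D := fun n x hx =>
    (closedBall_subset_closedBall (hηr n)).trans
      ((closedBall_subset_cthickening hx r).trans hrD)
  have hφc := hφ.contDiff.continuous
  have hφ'c := hφ.continuous_partialDeriv i
  have htest : ∀ n, IsTestFunction D (fun x => mollify (η n) c x * φ x) := fun n =>
    { contDiff := (contDiff_mollify (η n) hD c).mul hφ.contDiff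
      hasCompactSupport := hφ.hasCompactSupport.mul_left
      tsupport_subset := (tsupport_mul_subset_right).trans hφ.tsupport_subset }
  have hpd : ∀ n x, partialDeriv i (fun x => mollify (η n) c x * φ x) x
      = mollify (η n) c' x * φ x + mollify (η n) c x * partialDeriv i φ x := by
    intro n x
    have h1 : DifferentiableAt ℝ (mollify (η n) c) x :=
      (contDiff_mollify (η n) hD c).differentiable (by simp) x
    have h2 : DifferentiableAt ℝ φ x := hφ.contDiff.differentiable (by simp) x
    have h3 : partialDeriv i (fun x => mollify (η n) c x * φ x) x
        = partialDeriv i (mollify (η n) c) x * φ x + mollify (η n) c x * partialDeriv i φ x := by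
      simp only [partialDeriv]
      rw [fderiv_fun_mul h1 h2]
      simp; ring
    rw [h3]
    -- Off the support the factor `φ x` removes the derivative of the mollification, which is not
    -- controlled there.
    by_cases hx : x ∈ tsupport φ
    · rw [partialDeriv_mollify (η n) hD hc (hball n x hx)]
    · simp [image_eq_zero_of_notMem_tsupport hx]
  have hcm : ∀ n (b : LInf d D), Continuous (mollify (η n) b) := fun n b =>
    (contDiff_mollify (η n) hD b).continuous
  have hlim1 : Tendsto (fun n => ∫ x in D, p x *
        (mollify (η n) c' x * φ x + mollify (η n) c x * partialDeriv i φ x)) atTop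
      (𝓝 (∫ x in D, p x * (c' x * φ x + c x * partialDeriv i φ x))) := by
    have hint : Integrable (fun x => p x * (‖c'‖ * ‖φ x‖ + ‖c‖ * ‖partialDeriv i φ x‖))
        (volume.restrict D) :=
      integrable_lp_mul p (by fun_prop)
        ((hφ.hasCompactSupport.norm.mul_left).add
          ((hφ.hasCompactSupport_partialDeriv i).norm.mul_left))
    refine tendsto_integral_of_dominated_convergence _ (fun n => ?_) hint.norm
      (fun n => Eventually.of_forall fun x => ?_) ?_
    · exact (Lp.aestronglyMeasurable p).mul (((hcm n c').mul hφc).add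
        ((hcm n c).mul hφ'c)).aestronglyMeasurable
    · rw [norm_mul, norm_mul]
      refine mul_le_mul_of_nonneg_left ?_ (norm_nonneg _)
      refine (norm_add_le _ _).trans (le_trans ?_ (le_abs_self _))
      rw [norm_mul, norm_mul]
      gcongr
      · exact norm_mollify_le _ hD _ _
      · exact norm_mollify_le _ hD _ _
    · filter_upwards [hconv c, hconv c'] with x h1 h2
      exact ((h2.mul_const _).add (h1.mul_const _)).const_mul _
  have hlim2 : Tendsto (fun n => ∫ x in D, p' x * (mollify (η n) c x * φ x)) atTop
      (𝓝 (∫ x in D, p' x * (c x * φ x))) := by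
    have hint : Integrable (fun x => p' x * (‖c‖ * ‖φ x‖)) (volume.restrict D) :=
      integrable_lp_mul p' (by fun_prop) hφ.hasCompactSupport.norm.mul_left
    refine tendsto_integral_of_dominated_convergence _ (fun n => ?_) hint.norm
      (fun n => Eventually.of_forall fun x => ?_) ?_
    · exact (Lp.aestronglyMeasurable p').mul ((hcm n c).mul hφc).aestronglyMeasurable
    · rw [norm_mul, norm_mul, norm_mul, norm_mul, norm_norm, norm_norm]
      gcongr
      exact norm_mollify_le _ hD _ _
    · filter_upwards [hconv c] with x h1
      exact (h1.mul_const _).const_mul _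
  refine tendsto_nhds_unique hlim1 (hlim2.neg.congr fun n => ?_)
  have h := hp _ (htest n)
  simp only [hpd] at h
  exact h.symm

end Mollify

end

noncomputable section

/-! ### The diffusion form as a continuous bilinear map. -/

section Jets

open scoped RealInnerProductSpace

variable {d : ℕ} {D : Set (Space d)}

theorem L2.inner_eq_integral_mul (p q : L2 d D) : ⟪p, q⟫ = ∫ x in D, p x * q x := by
  rw [MeasureTheory.L2.inner_def]
  simp [mul_comm]

theorem L2.norm_sq_eq_integral (p : L2 d D) : ‖p‖ ^ 2 = ∫ x in D, p x ^ 2 := by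
  rw [← real_inner_self_eq_norm_sq, L2.inner_eq_integral_mul]
  simp [sq]

theorem L2.integrable_mul (p q : L2 d D) : Integrable (fun x => p x * q x) (volume.restrict D) :=
  (MeasureTheory.L2.integrable_inner (𝕜 := ℝ) p q).congr
    (Filter.Eventually.of_forall fun x => by simp [mul_comm])

/-- Multiplication of an `L^2` function by an `L^∞` function. -/
def lInfMul : LInf d D →L[ℝ] L2 d D →L[ℝ] L2 d D :=
  (ContinuousLinearMap.mul ℝ ℝ).holderL (volume.restrict D) ⊤ 2 2

theorem coeFn_lInfMul (c : LInf d D) (p : L2 d D) :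
    lInfMul c p =ᵐ[volume.restrict D] fun x => c x * p x :=
  (ContinuousLinearMap.mul ℝ ℝ).coeFn_holder c p

theorem norm_lInfMul_le (c : LInf d D) (p : L2 d D) : ‖lInfMul c p‖ ≤ ‖c‖ * ‖p‖ := by
  refine ((ContinuousLinearMap.mul ℝ ℝ).norm_holder_apply_apply_le c p).trans ?_
  have := ContinuousLinearMap.opNorm_mul_le ℝ ℝ
  calc _ ≤ 1 * ‖c‖ * ‖p‖ := by gcongr
    _ = _ := by ring

theorem inner_lInfMul (c : LInf d D) (p q : L2 d D) :
    ⟪lInfMul c p, q⟫ = ∫ x in D, c x * (p x * q x) := by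
  rw [L2.inner_eq_integral_mul]
  refine integral_congr_ae ?_
  filter_upwards [coeFn_lInfMul c p] with x hx
  rw [hx, mul_assoc]

theorem integrable_lInf_mul_mul (c : LInf d D) (p q : L2 d D) :
    Integrable (fun x => c x * (p x * q x)) (volume.restrict D) := by
  refine (L2.integrable_mul (lInfMul c p) q).congr ?_
  filter_upwards [coeFn_lInfMul c p] with x hx
  rw [hx, mul_assoc]

theorem L2Jet.norm_sq_eq (w : L2Jet d D) : ‖w‖ ^ 2 = ‖w.fst‖ ^ 2 + ∑ i, ‖w.snd i‖ ^ 2 := by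
  rw [WithLp.prod_norm_sq_eq_of_L2, PiLp.norm_sq_eq_of_L2]

theorem abs_sum_inner_lInfMul_le (c : LInf d D) (w v : L2Jet d D) :
    |∑ i, ⟪lInfMul c (w.snd i), v.snd i⟫| ≤ ‖c‖ * ‖w‖ * ‖v‖ := by
  have hsqrt : ∀ u : L2Jet d D, √(∑ i, ‖u.snd i‖ ^ 2) ≤ ‖u‖ := fun u => by
    rw [← Real.sqrt_sq (norm_nonneg u), L2Jet.norm_sq_eq]
    exact Real.sqrt_le_sqrt (by linarith [sq_nonneg ‖u.fst‖])
  calc |∑ i, ⟪lInfMul c (w.snd i), v.snd i⟫|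
      ≤ ∑ i, |⟪lInfMul c (w.snd i), v.snd i⟫| := Finset.abs_sum_le_sum_abs _ _
    _ ≤ ∑ i, ‖c‖ * (‖w.snd i‖ * ‖v.snd i‖) := by
        refine Finset.sum_le_sum fun i _ => (abs_real_inner_le_norm _ _).trans ?_
        rw [← mul_assoc]
        exact mul_le_mul_of_nonneg_right (norm_lInfMul_le _ _) (norm_nonneg _)
    _ = ‖c‖ * ∑ i, ‖w.snd i‖ * ‖v.snd i‖ := by rw [Finset.mul_sum]
    _ ≤ ‖c‖ * (√(∑ i, ‖w.snd i‖ ^ 2) * √(∑ i, ‖v.snd i‖ ^ 2)) := by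
        gcongr
        exact Real.sum_mul_le_sqrt_mul_sqrt _ _ _
    _ ≤ ‖c‖ * (‖w‖ * ‖v‖) := by
        gcongr
        exacts [hsqrt w, hsqrt v]
    _ = ‖c‖ * ‖w‖ * ‖v‖ := by ring

/-- The bilinear form `∫_D c ∇w · ∇v dx` on `H^1_0(D)` as a continuous bilinear map. -/
def gradForm (c : LInf d D) : SobolevH10 d D →L[ℝ] SobolevH10 d D →L[ℝ] ℝ :=
  LinearMap.mkContinuous₂
    (LinearMap.mk₂ ℝ (fun w v : SobolevH10 d D => ∑ i, ⟪lInfMul c (w.1.snd i), v.1.snd i⟫)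
      (fun w w' v => by
        simp only [Submodule.coe_add, WithLp.add_snd, PiLp.add_apply, map_add, inner_add_left,
          Finset.sum_add_distrib])
      (fun r w v => by
        simp only [Submodule.coe_smul, WithLp.smul_snd, PiLp.smul_apply, map_smul,
          real_inner_smul_left, Finset.mul_sum, smul_eq_mul])
      (fun w v v' => by
        simp only [Submodule.coe_add, WithLp.add_snd, PiLp.add_apply, inner_add_right,
          Finset.sum_add_distrib])
      (fun r w v => by
        simp only [Submodule.coe_smul, WithLp.smul_snd, PiLp.smul_apply,
          real_inner_smul_right, Finset.mul_sum, smul_eq_mul]))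
    ‖c‖ (fun w v => abs_sum_inner_lInfMul_le c w.1 v.1)

theorem gradForm_apply (c : LInf d D) (w v : SobolevH10 d D) :
    gradForm c w v = ∑ i, ⟪lInfMul c (w.1.snd i), v.1.snd i⟫ := rfl

theorem diffusionForm_eq_gradForm (A : W1Inf d D) (w v : SobolevH10 d D) :
    diffusionForm A w v = gradForm A.1.1 w v := by
  rw [gradForm_apply, diffusionForm]
  simp only [inner_lInfMul, Finset.mul_sum]
  exact integral_finsetSum _ fun i _ => integrable_lInf_mul_mul _ _ _

theorem abs_gradForm_le (c : LInf d D) (w v : SobolevH10 d D) :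
    |gradForm c w v| ≤ ‖c‖ * ‖w‖ * ‖v‖ :=
  abs_sum_inner_lInfMul_le c w.1 v.1

theorem gradForm_sub (c c' : LInf d D) (w v : SobolevH10 d D) :
    gradForm (c - c') w v = gradForm c w v - gradForm c' w v := by
  simp only [gradForm_apply, map_sub, sub_apply, inner_sub_left, Finset.sum_sub_distrib]

theorem gradForm_comm (c : LInf d D) (w v : SobolevH10 d D) :
    gradForm c w v = gradForm c v w := by
  simp only [gradForm_apply, inner_lInfMul]
  simp only [mul_comm]

theorem mul_norm_sq_le_inner_lInfMul {c : LInf d D} {m : ℝ}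
    (hc : ∀ᵐ x ∂(volume.restrict D), m ≤ c x) (p : L2 d D) :
    m * ‖p‖ ^ 2 ≤ ⟪lInfMul c p, p⟫ := by
  rw [inner_lInfMul, L2.norm_sq_eq_integral, ← integral_const_mul]
  refine integral_mono_ae ?_ (integrable_lInf_mul_mul c p p) ?_
  · simpa only [sq] using (L2.integrable_mul p p).const_mul m
  · filter_upwards [hc] with x hx
    rw [sq]
    exact mul_le_mul_of_nonneg_right hx (mul_self_nonneg _)

theorem inner_lInfMul_le_mul_norm_sq {c : LInf d D} {m : ℝ}
    (hc : ∀ᵐ x ∂(volume.restrict D), c x ≤ m) (p : L2 d D) :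
    ⟪lInfMul c p, p⟫ ≤ m * ‖p‖ ^ 2 := by
  rw [inner_lInfMul, L2.norm_sq_eq_integral, ← integral_const_mul]
  refine integral_mono_ae (integrable_lInf_mul_mul c p p) ?_ ?_
  · simpa only [sq] using (L2.integrable_mul p p).const_mul m
  · filter_upwards [hc] with x hx
    rw [sq]
    exact mul_le_mul_of_nonneg_right hx (mul_self_nonneg _)

/-! ### Density of test functions, Poincaré's inequality and integration by parts. -/

/-- `u` is the jet `(φ, ∇φ)` of some `φ ∈ C_c^∞(D)`. -/
def IsTestJet (u : L2Jet d D) : Prop :=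
  ∃ φ : Space d → ℝ, IsTestFunction D φ ∧ (u.fst =ᵐ[volume.restrict D] φ) ∧
    ∀ i, u.snd i =ᵐ[volume.restrict D] partialDeriv i φ

theorem isTestJet_zero : IsTestJet (0 : L2Jet d D) := by
  refine ⟨0, ⟨contDiff_const, HasCompactSupport.zero, by simp [tsupport]⟩, ?_, fun i => ?_⟩
  · exact Lp.coeFn_zero _ _ _
  · have : partialDeriv i (0 : Space d → ℝ) = 0 := by
      ext x
      simp [partialDeriv]
    rw [this]
    exact Lp.coeFn_zero _ _ _

theorem IsTestJet.add {u v : L2Jet d D} (hu : IsTestJet u) (hv : IsTestJet v) :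
    IsTestJet (u + v) := by
  obtain ⟨φ, hφ, hu1, hu2⟩ := hu
  obtain ⟨ψ, hψ, hv1, hv2⟩ := hv
  refine ⟨φ + ψ, ⟨hφ.contDiff.add hψ.contDiff, hφ.hasCompactSupport.add hψ.hasCompactSupport,
    (tsupport_add φ ψ).trans (Set.union_subset hφ.tsupport_subset hψ.tsupport_subset)⟩,
    ?_, fun i => ?_⟩
  · exact (Lp.coeFn_add u.fst v.fst).trans (hu1.add hv1)
  · have : partialDeriv i (φ + ψ) = partialDeriv i φ + partialDeriv i ψ := by
      ext x
      simp only [partialDeriv, Pi.add_apply]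
      rw [fderiv_add (hφ.contDiff.differentiable (by simp) x)
        (hψ.contDiff.differentiable (by simp) x)]
      rfl
    rw [this]
    exact (Lp.coeFn_add (u.snd i) (v.snd i)).trans ((hu2 i).add (hv2 i))

theorem IsTestJet.smul (r : ℝ) {u : L2Jet d D} (hu : IsTestJet u) : IsTestJet (r • u) := by
  obtain ⟨φ, hφ, hu1, hu2⟩ := hu
  refine ⟨r • φ, ⟨hφ.contDiff.const_smul r, hφ.hasCompactSupport.smul_left (f := fun _ => r),
    (tsupport_smul_subset_right (fun _ => r) φ).trans hφ.tsupport_subset⟩, ?_, fun i => ?_⟩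
  · exact (Lp.coeFn_smul r u.fst).trans (hu1.const_smul r)
  · have : partialDeriv i (r • φ) = r • partialDeriv i φ := by
      ext x
      simp only [partialDeriv, Pi.smul_apply]
      rw [fderiv_const_smul (hφ.contDiff.differentiable (by simp) x)]
      rfl
    rw [this]
    exact (Lp.coeFn_smul r (u.snd i)).trans ((hu2 i).const_smul r)

/-- Jets of test functions already form a subspace, so taking the span adds nothing and only the
closure has to be handled. -/
theorem SobolevH10.induction {P : L2Jet d D → Prop} (hP : IsClosed {u | P u})
    (htest : ∀ u, IsTestJet u → P u) {u : L2Jet d D} (hu : u ∈ SobolevH10 d D) : P u := by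
  refine closure_minimal (fun v hv => htest v ?_) hP hu
  exact Submodule.span_induction (fun w hw => hw) isTestJet_zero
    (fun _ _ _ _ => IsTestJet.add) (fun r _ _ => IsTestJet.smul r) hv

/-- Poincaré's inequality for test functions supported in a ball of radius `R`. -/
theorem integral_sq_le_of_isTestFunction {R : ℝ} (hR : ∀ x ∈ D, ‖x‖ ≤ R) (i : Fin d)
    {φ : Space d → ℝ} (hφ : IsTestFunction D φ) :
    ∫ x, φ x ^ 2 ≤ 4 * R ^ 2 * ∫ x, partialDeriv i φ x ^ 2 := by
  have hφc := hφ.contDiff.continuous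
  have hφ'c := hφ.continuous_partialDeriv i
  have hcs := hφ.hasCompactSupport
  have hcs' := hφ.hasCompactSupport_partialDeriv i
  have hdiff : Differentiable ℝ φ := hφ.contDiff.differentiable (by simp)
  -- The coordinate `x_i` has `∂_i x_i = 1`, so integration by parts gives `∫ φ² = -∫ 2 x_i φ ∂_i
  -- φ`.
  let ℓ : Space d →L[ℝ] ℝ := EuclideanSpace.proj i
  have hℓe : ∀ x, fderiv ℝ ℓ x (EuclideanSpace.single i 1) = 1 := fun x => by
    rw [ℓ.fderiv]
    simp [ℓ]
  have hg : ∀ x, fderiv ℝ (fun x => φ x * φ x) x (EuclideanSpace.single i 1)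
      = 2 * (φ x * partialDeriv i φ x) := fun x => by
    rw [fderiv_fun_mul (hdiff x) (hdiff x)]
    simp [partialDeriv]
    ring
  have hi1 : Integrable (fun x => φ x * φ x) :=
    (hφc.mul hφc).integrable_of_hasCompactSupport hcs.mul_left
  have hi2 : Integrable (fun x => ℓ x * (2 * (φ x * partialDeriv i φ x))) :=
    (by fun_prop : Continuous fun x => ℓ x * (2 * (φ x * partialDeriv i φ x)))
      |>.integrable_of_hasCompactSupport (hcs'.mul_left.mul_left.mul_left)
  have hi3 : Integrable (fun x => ℓ x * (φ x * φ x)) :=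
    (by fun_prop : Continuous fun x => ℓ x * (φ x * φ x))
      |>.integrable_of_hasCompactSupport (hcs.mul_left.mul_left)
  have hi4 : Integrable (fun x => partialDeriv i φ x ^ 2) := by
    simp only [sq]
    exact (hφ'c.mul hφ'c).integrable_of_hasCompactSupport hcs'.mul_left
  have hibp := integral_mul_fderiv_eq_neg_fderiv_mul_of_integrable (μ := volume) (f := ℓ)
    (g := fun x => φ x * φ x) (v := EuclideanSpace.single i 1)
    (by simpa only [hℓe, one_mul] using hi1) (by simpa only [hg] using hi2) hi3
    (fun x _ => ℓ.differentiableAt) (fun x _ => (hdiff x).mul (hdiff x))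
  simp only [hg, hℓe, one_mul] at hibp
  have hi1' : Integrable (fun x => φ x ^ 2) := by simpa only [sq] using hi1
  -- Young's inequality with weight `1 / 2` on `φ²`, so that this term can be absorbed on the left;
  -- absorbing doubles `2 * R ^ 2`.
  have hmono : ∫ x, -(ℓ x * (2 * (φ x * partialDeriv i φ x)))
      ≤ ∫ x, (1 / 2 * φ x ^ 2 + 2 * R ^ 2 * partialDeriv i φ x ^ 2) := by
    refine integral_mono hi2.neg ((hi1'.const_mul _).add (hi4.const_mul _)) fun x => ?_
    simp only
    by_cases hx : x ∈ tsupport φ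
    · have hxR : |ℓ x| ≤ R := (PiLp.norm_apply_le x i).trans (hR x (hφ.tsupport_subset hx))
      have h1 : ℓ x ^ 2 ≤ R ^ 2 := sq_le_sq' (by linarith [neg_abs_le (ℓ x)])
        ((le_abs_self _).trans hxR)
      nlinarith [sq_nonneg (φ x + 2 * ℓ x * partialDeriv i φ x),
        mul_le_mul_of_nonneg_right h1 (sq_nonneg (partialDeriv i φ x))]
    · rw [image_eq_zero_of_notMem_tsupport hx]
      have := mul_nonneg (sq_nonneg R) (sq_nonneg (partialDeriv i φ x))
      nlinarith
  rw [integral_neg, hibp, neg_neg, integral_add (hi1'.const_mul _) (hi4.const_mul _),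
    integral_const_mul, integral_const_mul] at hmono
  simp only [← sq] at hmono
  linarith

theorem norm_sq_eq_integral_of_tsupport_subset {φ : Space d → ℝ} (hφ : tsupport φ ⊆ D) {p : L2 d D}
    (hp : p =ᵐ[volume.restrict D] φ) : ‖p‖ ^ 2 = ∫ x, φ x ^ 2 := by
  rw [L2.norm_sq_eq_integral, ← setIntegral_eq_integral_of_forall_compl_eq_zero (s := D)
    (f := fun x => φ x ^ 2)]
  · refine integral_congr_ae ?_
    filter_upwards [hp] with x hx
    rw [hx]
  · intro x hx
    rw [image_eq_zero_of_notMem_tsupport fun h => hx (hφ h)]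
    simp

/-- Poincaré's inequality on `H^1_0(D)` for `D` contained in a ball of radius `R`. -/
theorem norm_sq_le_sum_of_mem_sobolevH10 {R : ℝ} (hR : ∀ x ∈ D, ‖x‖ ≤ R) (hd : 1 ≤ d)
    {u : L2Jet d D} (hu : u ∈ SobolevH10 d D) :
    ‖u‖ ^ 2 ≤ (4 * R ^ 2 + 1) * ∑ i, ‖u.snd i‖ ^ 2 := by
  refine SobolevH10.induction (P := fun u => ‖u‖ ^ 2 ≤ (4 * R ^ 2 + 1) * ∑ i, ‖u.snd i‖ ^ 2)
    (isClosed_le (by fun_prop) (by fun_prop)) ?_ hu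
  rintro u ⟨φ, hφ, h1, h2⟩
  -- One direction suffices for Poincaré; `1 ≤ d` provides it.
  let i : Fin d := ⟨0, hd⟩
  have h3 := integral_sq_le_of_isTestFunction hR i hφ
  have hsub : tsupport (partialDeriv i φ) ⊆ D := by
    refine ((closure_mono fun x hx => ?_).trans (tsupport_fderiv_subset ℝ (f := φ))).trans
      hφ.tsupport_subset
    exact fun h0 => hx (by simp [partialDeriv, h0])
  rw [← norm_sq_eq_integral_of_tsupport_subset hφ.tsupport_subset h1,
    ← norm_sq_eq_integral_of_tsupport_subset hsub (h2 i)] at h3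
  have h4 : ‖u.snd i‖ ^ 2 ≤ ∑ j, ‖u.snd j‖ ^ 2 :=
    Finset.single_le_sum (f := fun j => ‖u.snd j‖ ^ 2) (fun _ _ => sq_nonneg _)
      (Finset.mem_univ i)
  rw [L2Jet.norm_sq_eq]
  nlinarith [mul_le_mul_of_nonneg_left h4 (by positivity : 0 ≤ 4 * R ^ 2)]

/-- Integration by parts against `H^1_0(D)`, with the product rule. -/
theorem inner_lInfMul_snd (hD : IsOpen D) {i : Fin d} {c c' : LInf d D} {p p' : L2 d D}
    (hc : IsWeakPartial D i c c') (hp : IsWeakPartial D i p p') {v : L2Jet d D}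
    (hv : v ∈ SobolevH10 d D) :
    ⟪lInfMul c p, v.snd i⟫ = -⟪lInfMul c' p + lInfMul c p', v.fst⟫ := by
  refine SobolevH10.induction
    (P := fun v => ⟪lInfMul c p, v.snd i⟫ = -⟪lInfMul c' p + lInfMul c p', v.fst⟫)
    (isClosed_eq (by fun_prop) (by fun_prop)) ?_ hv
  rintro v ⟨φ, hφ, h1, h2⟩
  have h := isWeakPartial_mul hD hc hp hφ
  have e1 : ∫ x in D, p x * (c' x * φ x + c x * partialDeriv i φ x)
      = ⟪lInfMul c' p, v.fst⟫ + ⟪lInfMul c p, v.snd i⟫ := by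
    rw [inner_lInfMul, inner_lInfMul, ← integral_add (integrable_lInf_mul_mul _ _ _)
      (integrable_lInf_mul_mul _ _ _)]
    refine integral_congr_ae ?_
    filter_upwards [h1, h2 i] with x hx1 hx2
    rw [hx1, hx2]
    ring
  have e2 : ∫ x in D, p' x * (c x * φ x) = ⟪lInfMul c p', v.fst⟫ := by
    rw [inner_lInfMul]
    refine integral_congr_ae ?_
    filter_upwards [h1] with x hx1
    rw [hx1]
    ring
  rw [e1, e2] at h
  rw [inner_add_left]
  linarith

/-- `div (A ∇w)` for `A ∈ W^{1,∞}(D)` and `w ∈ H^2(D)`. -/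
def divGrad (A : W1Inf d D) (w : SobolevH2 d D) : L2 d D :=
  ∑ i, (lInfMul (A.1.2 i) (w.1.fst.snd i) + lInfMul A.1.1 (w.1.snd (i, i)))

/-- Writes the form as an `L²` functional of `v`, so that a perturbation of the coefficient becomes
a right-hand side to which `H²`-regularity applies. -/
theorem gradForm_eq_neg_inner_divGrad (hD : IsOpen D) (A : W1Inf d D) {w : SobolevH2 d D}
    {u : SobolevH10 d D} (hw : SobolevH2.toH1 w = u) (v : SobolevH10 d D) :
    gradForm A.1.1 u v = -⟪divGrad A w, v.1.fst⟫ := by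
  rw [gradForm_apply, divGrad, sum_inner, ← Finset.sum_neg_distrib, ← hw]
  exact Finset.sum_congr rfl fun i _ => inner_lInfMul_snd hD (A.2 i) (w.2.2 i i) v.2

theorem norm_divGrad_le (A : W1Inf d D) (w : SobolevH2 d D) :
    ‖divGrad A w‖ ≤ 2 * d * ‖A‖ * ‖w‖ := by
  have hA : ‖A.1.1‖ ≤ ‖A‖ := norm_fst_le A.1
  have hA' : ∀ i, ‖A.1.2 i‖ ≤ ‖A‖ := fun i => (norm_le_pi_norm A.1.2 i).trans (norm_snd_le A.1)
  have hw : ∀ i, ‖w.1.fst.snd i‖ ≤ ‖w‖ := fun i =>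
    (PiLp.norm_apply_le _ i).trans ((WithLp.norm_snd_le _ _).trans (WithLp.norm_fst_le _ _))
  have hw' : ∀ i, ‖w.1.snd (i, i)‖ ≤ ‖w‖ := fun i =>
    (PiLp.norm_apply_le _ _).trans (WithLp.norm_snd_le _ _)
  calc ‖divGrad A w‖ ≤ ∑ _i : Fin d, 2 * (‖A‖ * ‖w‖) := by
        refine norm_sum_le_of_le _ fun i _ => (norm_add_le _ _).trans ?_
        rw [two_mul]
        refine add_le_add ((norm_lInfMul_le _ _).trans ?_) ((norm_lInfMul_le _ _).trans ?_)
        · exact mul_le_mul (hA' i) (hw i) (norm_nonneg _) (norm_nonneg _)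
        · exact mul_le_mul hA (hw' i) (norm_nonneg _) (norm_nonneg _)
    _ = 2 * d * ‖A‖ * ‖w‖ := by simp; ring

end Jets

end

noncomputable section

/-! ### Galerkin error estimates for the diffusion problem. -/

section Convergence

open scoped RealInnerProductSpace

variable {d : ℕ} {D : Set (Space d)}

instance : CompleteSpace (SobolevH10 d D) :=
  inferInstanceAs (CompleteSpace (Submodule.topologicalClosure _))

theorem isGalerkinSolution_iff {A : W1Inf d D} {X : Submodule ℝ (SobolevH10 d D)} {f : L2 d D}
    {u : SobolevH10 d D} :
    IsGalerkinSolution A X f u ↔ u ∈ X ∧ ∀ v ∈ X, gradForm A.1.1 u v = ⟪f, v.1.fst⟫ := by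
  simp only [IsGalerkinSolution, diffusionForm_eq_gradForm, L2.inner_eq_integral_mul]

theorem CoefficientBounds.le_gradForm {A : W1Inf d D} {Amin Amax R : ℝ}
    (hA : CoefficientBounds A Amin Amax) (hmin : 0 < Amin) (hR : ∀ x ∈ D, ‖x‖ ≤ R) (hd : 1 ≤ d)
    (v : SobolevH10 d D) : Amin / (4 * R ^ 2 + 1) * ‖v‖ ^ 2 ≤ gradForm A.1.1 v v := by
  have hp := norm_sq_le_sum_of_mem_sobolevH10 hR hd v.2
  calc Amin / (4 * R ^ 2 + 1) * ‖v‖ ^ 2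
      ≤ Amin / (4 * R ^ 2 + 1) * ((4 * R ^ 2 + 1) * ∑ i, ‖v.1.snd i‖ ^ 2) := by
        gcongr
        exact hp
    _ = ∑ i, Amin * ‖v.1.snd i‖ ^ 2 := by
        rw [← mul_assoc, div_mul_cancel₀ _ (by positivity), Finset.mul_sum]
    _ ≤ gradForm A.1.1 v v := by
        rw [gradForm_apply]
        exact Finset.sum_le_sum fun i _ =>
          mul_norm_sq_le_inner_lInfMul (hA.mono fun _ h => h.1) _

theorem CoefficientBounds.gradForm_le {A : W1Inf d D} {Amin Amax : ℝ}
    (hA : CoefficientBounds A Amin Amax) (hmax : 0 ≤ Amax) (v : SobolevH10 d D) :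
    gradForm A.1.1 v v ≤ Amax * ‖v‖ ^ 2 := by
  calc gradForm A.1.1 v v ≤ ∑ i, Amax * ‖v.1.snd i‖ ^ 2 := by
        rw [gradForm_apply]
        exact Finset.sum_le_sum fun i _ =>
          inner_lInfMul_le_mul_norm_sq (hA.mono fun _ h => h.2) _
    _ = Amax * ∑ i, ‖v.1.snd i‖ ^ 2 := by rw [Finset.mul_sum]
    _ ≤ Amax * ‖v‖ ^ 2 := by
        gcongr
        rw [← Submodule.norm_coe, L2Jet.norm_sq_eq]
        linarith [sq_nonneg ‖v.1.fst‖]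

theorem existsUnique_isGalerkinSolution {A : W1Inf d D} {Amin Amax R : ℝ}
    (hA : CoefficientBounds A Amin Amax) (hmin : 0 < Amin) (hR : ∀ x ∈ D, ‖x‖ ≤ R) (hd : 1 ≤ d)
    (X : Submodule ℝ (SobolevH10 d D)) [CompleteSpace X] (f : L2 d D) :
    ∃! u, IsGalerkinSolution A X f u := by
  let F : SobolevH10 d D →L[ℝ] ℝ :=
    (innerSL ℝ f).comp ((WithLp.fstL 2 ℝ (L2 d D) (PiLp 2 fun _ : Fin d => L2 d D)).comp
      (SobolevH10 d D).subtypeL)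
  have hF : ∀ v : SobolevH10 d D, F v = ⟪f, v.1.fst⟫ := fun _ => rfl
  have hcoer := hA.le_gradForm hmin hR hd
  have h := existsUnique_galerkin (H := SobolevH10 d D) X (gradForm A.1.1)
    (α := Amin / (4 * R ^ 2 + 1)) (by positivity) (fun v => by exact hcoer v) F
  simpa only [isGalerkinSolution_iff, hF] using h

theorem isGalerkinSolution_galerkinSolution {A : W1Inf d D} {X : Submodule ℝ (SobolevH10 d D)}
    {f : L2 d D} (h : ∃ u, IsGalerkinSolution A X f u) :
    IsGalerkinSolution A X f (galerkinSolution A X f) := by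
  rw [galerkinSolution, dif_pos h]
  exact h.choose_spec

/-- Galerkin orthogonality. -/
theorem IsGalerkinSolution.gradForm_sub_eq_zero {A : W1Inf d D} {f : L2 d D}
    {X : Submodule ℝ (SobolevH10 d D)} {u p : SobolevH10 d D} (hu : IsGalerkinSolution A ⊤ f u)
    (hp : IsGalerkinSolution A X f p) (v : SobolevH10 d D) (hv : v ∈ X) :
    gradForm A.1.1 (u - p) v = 0 := by
  rw [isGalerkinSolution_iff] at hu hp
  rw [ContinuousLinearMap.map_sub₂, hu.2 v trivial, hp.2 v hv, sub_self]

/-- The difference of the exact solutions for the coefficients `A` and `B` solves the equation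
with coefficient `A` and right-hand side `div ((A - B) ∇w)`. -/
theorem IsGalerkinSolution.sub_of_toH1_eq (hD : IsOpen D) {A B : W1Inf d D} {f : L2 d D}
    {u v : SobolevH10 d D} {w : SobolevH2 d D} (hu : IsGalerkinSolution A ⊤ f u)
    (hv : IsGalerkinSolution B ⊤ f v) (hw : SobolevH2.toH1 w = v) :
    IsGalerkinSolution A ⊤ (divGrad (A - B) w) (u - v) := by
  rw [isGalerkinSolution_iff] at hu hv ⊢
  refine ⟨trivial, fun y _ => ?_⟩
  -- Both solutions share `f`, so the form of `A` at `u - v` equals minus the form of `A - B` at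
  -- `v`; the minus sign cancels with that of integration by parts.
  have h1 := gradForm_eq_neg_inner_divGrad hD (A - B) hw y
  have h2 : gradForm (A - B).1.1 v y = gradForm A.1.1 v y - gradForm B.1.1 v y :=
    gradForm_sub _ _ _ _
  rw [ContinuousLinearMap.map_sub₂, hu.2 y trivial, ← hv.2 y trivial]
  linarith

/-- Counting powers of `Amin⁻¹`: two applications of regularity give four and the square root is
allowed one more, hence five. The constant `c` stands for the Poincaré constant and `κ` for the `2 *
d` of `norm_divGrad_le`. -/
theorem sqrt_mul_galerkin_bound_le {Amin Amax Creg M c η δ F κ : ℝ} (hmin : 0 < Amin)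
    (hmin1 : Amin ≤ 1) (hmax : Amin ≤ Amax) (hCreg : 0 ≤ Creg) (hM : 0 ≤ M) (hc : 0 < c)
    (hη : 0 ≤ η) (hδ : 0 ≤ δ) (hF : 0 ≤ F) (hκ : 0 ≤ κ) :
    √(Amax / (Amin / c)) *
      (η * (Creg / Amin ^ 2 * (1 + M) * (κ * δ * (Creg / Amin ^ 2 * (1 + M) * F)))
        + (Amin / c)⁻¹ * δ * (η * (Creg / Amin ^ 2 * (1 + M) * F)))
      ≤ √c * Creg * (κ * Creg + c) * ((Amin ^ 5)⁻¹ * √Amax * (1 + M) ^ 2) * η * δ * F := by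
  have hinv : 1 ≤ Amin⁻¹ := (one_le_inv₀ hmin).2 hmin1
  -- `Amin ≤ 1` lets `Amin⁻¹` replace its square root.
  have hsqrt : √(Amax / (Amin / c)) ≤ √c * √Amax * Amin⁻¹ := by
    have h1 : Amax / (Amin / c) = c * (Amax * Amin⁻¹) := by field_simp
    rw [h1, Real.sqrt_mul hc.le, Real.sqrt_mul (hmin.le.trans hmax), ← mul_assoc]
    gcongr
    rw [Real.sqrt_le_left (by linarith)]
    nlinarith
  have hsum : η * (Creg / Amin ^ 2 * (1 + M) * (κ * δ * (Creg / Amin ^ 2 * (1 + M) * F)))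
      + (Amin / c)⁻¹ * δ * (η * (Creg / Amin ^ 2 * (1 + M) * F))
      ≤ η * Creg * δ * F * (Amin⁻¹ ^ 4 * (1 + M) ^ 2) * (κ * Creg + c) := by
    -- The second summand uses regularity once and coercivity once, so it carries lower powers; they
    -- are raised to match the first.
    have h2 : Amin⁻¹ ^ 3 * (1 + M) ≤ Amin⁻¹ ^ 4 * (1 + M) ^ 2 := by
      gcongr
      · norm_num
      · exact le_self_pow₀ (by linarith) two_ne_zero
    calc _ = η * Creg * δ * F *
          (κ * Creg * (Amin⁻¹ ^ 4 * (1 + M) ^ 2) + c * (Amin⁻¹ ^ 3 * (1 + M))) := by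
          field_simp
      _ ≤ η * Creg * δ * F *
          (κ * Creg * (Amin⁻¹ ^ 4 * (1 + M) ^ 2) + c * (Amin⁻¹ ^ 4 * (1 + M) ^ 2)) := by
          gcongr
      _ = _ := by ring
  calc _ ≤ (√c * √Amax * Amin⁻¹) *
        (η * Creg * δ * F * (Amin⁻¹ ^ 4 * (1 + M) ^ 2) * (κ * Creg + c)) := by
        gcongr
    _ = _ := by
        rw [← inv_pow]
        ring

theorem norm_galerkin_error_sub_le_of_h2Regular (hD : IsOpen D) {R : ℝ} (hR : ∀ x ∈ D, ‖x‖ ≤ R)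
    (hd : 1 ≤ d) {Amin Amax Creg η M : ℝ} (hmin : 0 < Amin) (hmin1 : Amin ≤ 1)
    (hmax : Amin ≤ Amax) (hCreg : 0 ≤ Creg) (hη : 0 ≤ η) {A B : W1Inf d D}
    (hA : CoefficientBounds A Amin Amax) (hB : CoefficientBounds B Amin Amax)
    (hAreg : H2Regular A Amin Creg) (hBreg : H2Regular B Amin Creg) (hAM : ‖A‖ ≤ M)
    (hBM : ‖B‖ ≤ M) {X : Submodule ℝ (SobolevH10 d D)} [CompleteSpace X]
    (happrox : ∀ (u : SobolevH10 d D) (w : SobolevH2 d D), SobolevH2.toH1 w = u →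
      ⨅ v : X, ‖u - v‖ ≤ η * ‖w‖) {f : L2 d D} {u w p q : SobolevH10 d D}
    (hu : IsGalerkinSolution A ⊤ f u) (hw : IsGalerkinSolution B ⊤ f w)
    (hp : IsGalerkinSolution A X f p) (hq : IsGalerkinSolution B X f q) :
    ‖(u - p) - (w - q)‖ ≤ √(4 * R ^ 2 + 1) * Creg * (2 * d * Creg + (4 * R ^ 2 + 1)) *
      ((Amin ^ 5)⁻¹ * √Amax * (1 + M) ^ 2) * η * ‖A - B‖ * ‖f‖ := by
  obtain ⟨w₂, hw₂, hw₂n⟩ := hBreg f w hw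
  -- Regularity is used a second time, now for `u - w` with the right-hand side `div ((A - B)∇w)`.
  obtain ⟨z₂, hz₂, hz₂n⟩ := hAreg _ _ (hu.sub_of_toH1_eq hD hw hw₂)
  have hM : 0 ≤ M := (norm_nonneg A).trans hAM
  have hw₂M : ‖w₂‖ ≤ Creg / Amin ^ 2 * (1 + M) * ‖f‖ := hw₂n.trans (by gcongr)
  have hz₂M : ‖z₂‖ ≤ Creg / Amin ^ 2 * (1 + M) *
      (2 * d * ‖A - B‖ * (Creg / Amin ^ 2 * (1 + M) * ‖f‖)) :=
    hz₂n.trans (by gcongr; exact (norm_divGrad_le _ _).trans (by gcongr))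
  have hA₁ := hA.le_gradForm hmin hR hd
  have hB₁ := hB.le_gradForm hmin hR hd
  have hA₂ := hA.gradForm_le (hmin.le.trans hmax)
  have hB₂ := hB.gradForm_le (hmin.le.trans hmax)
  have hdiff : ∀ v v', |gradForm A.1.1 v v' - gradForm B.1.1 v v'| ≤ ‖A - B‖ * ‖v‖ * ‖v'‖ :=
    fun v v' => by
      rw [← gradForm_sub]
      refine (abs_gradForm_le _ _ _).trans ?_
      gcongr
      exact norm_fst_le (A - B).1
  have hup := hu.gradForm_sub_eq_zero hp
  have hwq := hw.gradForm_sub_eq_zero hq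
  have ha := (happrox _ _ hz₂).trans (mul_le_mul_of_nonneg_left hz₂M hη)
  have hb := (happrox _ _ hw₂).trans (mul_le_mul_of_nonneg_left hw₂M hη)
  have key := norm_galerkin_error_sub_le (H := SobolevH10 d D) (X := X) (B₁ := gradForm A.1.1)
    (B₂ := gradForm B.1.1) (α := Amin / (4 * R ^ 2 + 1)) (β := Amax) (δ := ‖A - B‖)
    (by positivity) (norm_nonneg _) (fun v => by exact hA₁ v) (fun v => by exact hA₂ v)
    (fun v v' => by exact gradForm_comm _ v v') (fun v => by exact hB₁ v)
    (fun v => by exact hB₂ v) (fun v v' => by exact gradForm_comm _ v v')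
    (fun v v' => by exact hdiff v v') hp.1 hq.1 (fun v hv => by exact hup v hv)
    (fun v hv => by exact hwq v hv) ha hb
  exact key.trans (sqrt_mul_galerkin_bound_le hmin hmin1 hmax hCreg hM (by positivity) hη
    (norm_nonneg _) (norm_nonneg _) (by positivity))

end Convergence

end

/-! ### The double-difference estimate. -/

theorem proposition3p8 (d : ℕ) (hd : 1 ≤ d) (D : Set (Space d)) (hDopen : IsOpen D)
    (hDbdd : Bornology.IsBounded D)
    (Capprox Creg : ℝ) (hCapprox : 0 < Capprox) (hCreg : 0 < Creg) :
    ∃ K : ℝ, 0 < K ∧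
      ∀ (Cunif Amin Amax : ℝ), 0 < Cunif → 0 < Amin → Amin ≤ 1 → Amin ≤ Amax →
      ∀ (X : ℕ → Submodule ℝ (SobolevH10 d D)) (h : ℕ → ℝ),
      IsApproximationSequence X h Capprox Cunif →
      ∀ (Ω : Type*) (A : ℕ → Ω → W1Inf d D) (f : L2 d D) (ω : Ω),
      (∀ ν, CoefficientBounds (A ν ω) Amin Amax) →
      (∀ ν, H2Regular (A ν ω) Amin Creg) →
      (∀ ℓ ν, ∃! u, IsGalerkinSolution (A ν ω) (X ℓ) f u) ∧
      ∀ ℓ ν, 1 ≤ ℓ → 1 ≤ ν →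
        ‖doubleDifference (fun μ => A μ ω) X f ℓ ν‖
          ≤ K * (Cunif⁻¹ * (Amin ^ 5)⁻¹ * √Amax * (1 + max ‖A ν ω‖ ‖A (ν - 1) ω‖) ^ 2)
              * h ℓ * ‖A ν ω - A (ν - 1) ω‖ * ‖f‖ := by
  obtain ⟨R, hR⟩ := hDbdd.exists_norm_le
  -- The domain enters only through the radius `R` of a ball containing it; the factor 2 accounts
  -- for the levels `ℓ - 1` and `ℓ`.
  refine ⟨2 * (√(4 * R ^ 2 + 1) * Creg * (2 * d * Creg + (4 * R ^ 2 + 1)) * Capprox),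
    by positivity, ?_⟩
  intro Cunif Amin Amax hCunif hmin hmin1 hmax X h hX Ω A f ω hA hreg
  have hcomp : ∀ ℓ, CompleteSpace (X ℓ) := fun ℓ => (hX.closed ℓ).completeSpace_coe
  have hex : ∀ ℓ ν, ∃! u, IsGalerkinSolution (A ν ω) (X ℓ) f u := fun ℓ ν =>
    existsUnique_isGalerkinSolution (hA ν) hmin hR hd (X ℓ) f
  refine ⟨hex, fun ℓ ν hℓ _ => ?_⟩
  have hcompTop : CompleteSpace (⊤ : Submodule ℝ (SobolevH10 d D)) :=
    isClosed_univ.completeSpace_coe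
  have hexact : ∀ ν, ∃ u, IsGalerkinSolution (A ν ω) ⊤ f u := fun ν =>
    (existsUnique_isGalerkinSolution (hA ν) hmin hR hd ⊤ f).exists
  choose u hu using hexact
  have hsol : ∀ ℓ ν, IsGalerkinSolution (A ν ω) (X ℓ) f (galerkinSolution (A ν ω) (X ℓ) f) :=
    fun ℓ ν => isGalerkinSolution_galerkinSolution (hex ℓ ν).exists
  have herr : ∀ k, _ := fun k =>
    norm_galerkin_error_sub_le_of_h2Regular hDopen hR hd hmin hmin1 hmax hCreg.le
      (mul_nonneg hCapprox.le (hX.pos k).le) (hA ν) (hA (ν - 1)) (hreg ν) (hreg (ν - 1))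
      (le_max_left _ _) (le_max_right _ _) (hX.approx k) (hu ν) (hu (ν - 1))
      (hsol k ν) (hsol k (ν - 1))
  have hh : h (ℓ - 1) ≤ Cunif⁻¹ * h ℓ := by
    have := hX.unif (ℓ - 1)
    rw [Nat.sub_add_cancel hℓ] at this
    rwa [← div_eq_inv_mul, le_div_iff₀ hCunif, mul_comm]
  -- This bypasses `Cunif ≤ 1`, which is not assumed: monotonicity of `h` and the bound on `h (ℓ -
  -- 1)` suffice.
  have hh' : h ℓ ≤ Cunif⁻¹ * h ℓ := (hX.antitone (Nat.sub_le ℓ 1)).trans hh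
  -- The exact solutions `u ν` and `u (ν - 1)` are added and subtracted, leaving the error gap on
  -- level `ℓ - 1` minus that on level `ℓ`.
  have hsplit : doubleDifference (fun μ => A μ ω) X f ℓ ν
      = ((u ν - galerkinSolution (A ν ω) (X (ℓ - 1)) f)
          - (u (ν - 1) - galerkinSolution (A (ν - 1) ω) (X (ℓ - 1)) f))
        - ((u ν - galerkinSolution (A ν ω) (X ℓ) f)
          - (u (ν - 1) - galerkinSolution (A (ν - 1) ω) (X ℓ) f)) := by
    rw [doubleDifference]
    abel
  rw [hsplit]
  refine (norm_sub_le _ _).trans ((add_le_add (herr (ℓ - 1)) (herr ℓ)).trans ?_)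
  have hM : 0 ≤ 1 + max ‖A ν ω‖ ‖A (ν - 1) ω‖ := by positivity
  have hbound : √(4 * R ^ 2 + 1) * Creg * (2 * d * Creg + (4 * R ^ 2 + 1)) *
      ((Amin ^ 5)⁻¹ * √Amax * (1 + max ‖A ν ω‖ ‖A (ν - 1) ω‖) ^ 2) * Capprox *
      ‖A ν ω - A (ν - 1) ω‖ * ‖f‖ * (h (ℓ - 1) + h ℓ) ≤
      √(4 * R ^ 2 + 1) * Creg * (2 * d * Creg + (4 * R ^ 2 + 1)) *
      ((Amin ^ 5)⁻¹ * √Amax * (1 + max ‖A ν ω‖ ‖A (ν - 1) ω‖) ^ 2) * Capprox *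
      ‖A ν ω - A (ν - 1) ω‖ * ‖f‖ * (Cunif⁻¹ * h ℓ + Cunif⁻¹ * h ℓ) := by
    gcongr
  calc _ = _ := by ring
    _ ≤ _ := hbound
    _ = _ := by ring
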